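/- For integers $d,w\ge 0$ let $m=\binom dw$ and let $Q_{d,w}\in\{\pm1\}^{m\times 2^d}$ be the matrix of the $w$-way parity queries on $\{\pm1\}^d$: its rows are indexed by the sets $P\subseteq\{1,\dots,d\}$ with $|P|=w$, its columns by $u\in\{\pm1\}^d$, and its $(P,u)$ entry is $\prod_{i\in P}u_i$. A mechanism $\mathcal M$ assigns to each $x\in\mathbb R^{2^d}$ a random vector $\mathcal M(x)\in\mathbb R^m$. It is $(\epsilon,\delta)$-differentially private if $\Pr[\mathcal M(x)\in S]\le e^{\epsilon}\Pr[\mathcal M(x')\in S]+\delta$ for every measurable $S\subseteq\mathbb R^m$ and all $x,x'\in\mathbb R^{2^d}$ with $\|x-x'\|_1\le 1$. Its worst-case $\ell_p^p$ error is $$\mathsf{err}_{\ell_p^p}(\mathcal M,Q_{d,w})=\sup_{x\in\mathbb R^{2^d}}\left(\mathbb E\,\|\mathcal M(x)-Q_{d,w}x\|_p^p\right)^{1/p}\in[0,\infty].$$ **Theorem.** For every $K>0$ there is a constant $c>0$, depending only on $K$, such that for all integers $d,w\ge 0$, all $p\in[2,\infty)$, all $\epsilon>0$ and all $\delta\in[0,1)$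 with $\delta\le K\epsilon$, every $(\epsilon,\delta)$-differentially private mechanism $\mathcal M:\mathbb R^{2^d}\to\mathbb R^m$ satisfies $$\mathsf{err}_{\ell_p^p}(\mathcal M,Q_{d,w})\;\ge\; c\,\frac{1-\delta}{e^{3\epsilon}-1}\,\binom dw^{1/2+1/p}.$$ -/

import Mathlib

open MeasureTheory
open scoped ENNReal Matrix

noncomputable section

/-- A randomized mechanism with inputs in `ℝ^ι` and outputs in `ℝ^κ`: every dataset `x` is sent to
the law of the output on `x`. No regularity in `x` is required. -/
abbrev Mechanism (ι κ : Type) : Type :=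
  (ι → ℝ) → ProbabilityMeasure (κ → ℝ)

/-- Two datasets are neighboring if their `ℓ₁` distance is at most `1`. -/
def Neighboring {ι : Type} [Fintype ι] (x y : ι → ℝ) : Prop :=
  ∑ i, |x i - y i| ≤ 1

/-- `(ε, δ)`-differential privacy. -/
def IsDifferentiallyPrivate {ι κ : Type} [Fintype ι] (M : Mechanism ι κ) (ε δ : ℝ) : Prop :=
  ∀ x y : ι → ℝ, Neighboring x y → ∀ S : Set (κ → ℝ), MeasurableSet S →
    (M x : Measure (κ → ℝ)).real S ≤ Real.exp ε * (M y : Measure (κ → ℝ)).real S + δ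

/-- The worst-case `ℓ_p^p` error `sup_x (E ‖M(x) - A x‖_p^p)^{1/p}` of a mechanism that answers the
linear queries given by the rows of `A`, as an element of `[0, ∞]`. -/
def lppError {ι κ : Type} [Fintype ι] [Fintype κ] (p : ℝ) (M : Mechanism ι κ)
    (A : Matrix κ ι ℝ) : ℝ≥0∞ :=
  ⨆ x : ι → ℝ,
    (∫⁻ y, ENNReal.ofReal (∑ k, |y k - (A *ᵥ x) k| ^ p) ∂(M x : Measure (κ → ℝ))) ^ (1 / p)

/-- The data universe `{±1}^d`. -/
abbrev SignCube (d : ℕ) : Type := Fin d → ℤˣ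

/-- The `w`-element subsets of `[d]`, indexing the `w`-way parity queries. -/
abbrev ParityIndex (d w : ℕ) : Type := {P : Finset (Fin d) // P.card = w}

/-- The parity query `q_P(u) = ∏_{i ∈ P} u_i` on `{±1}^d`. -/
def parityQuery {d : ℕ} (P : Finset (Fin d)) (u : SignCube d) : ℝ :=
  ∏ i ∈ P, ((u i : ℤ) : ℝ)

/-- The `binom(d, w) × 2^d` query matrix of the `w`-way parity queries. -/
def parityMatrix (d w : ℕ) : Matrix (ParityIndex d w) (SignCube d) ℝ :=
  fun P u => parityQuery P.1 u

end

/-! The rows of the query matrix `A` are orthogonal sign vectors. Put the datasets on a cube of side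
`t`. Flipping coordinate `j` moves `(Aᵀ A x)_j` by `t m`, yet privacy keeps the two output laws
close, so `(Aᵀ y)_j` has large mean squared error at one of the two datasets
(`one_sub_mul_sq_le_of_indistinguishable`). Averaging over the cube, summing over `j` and applying
Parseval turns this into squared error of order `t² m²` at some dataset
(`exists_le_lintegral_sq_error`); truncation passes from squares to `p`-th powers. For small `ε`,
group privacy allows `t` of order `1 / ε`; otherwise `t = 1`. -/

/-- Group privacy, along segments: datasets at `ℓ₁` distance at most `n`. -/
theorem IsDifferentiallyPrivate.group {ι κ : Type} [Fintype ι] {M : Mechanism ι κ} {ε δ : ℝ}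
    (hM : IsDifferentiallyPrivate M ε δ) (hε : 0 ≤ ε) (hδ : 0 ≤ δ) (n : ℕ) (x y : ι → ℝ)
    (hxy : ∑ i, |x i - y i| ≤ n) (S : Set (κ → ℝ)) (hS : MeasurableSet S) :
    (M x : Measure (κ → ℝ)).real S ≤
      Real.exp (n * ε) * (M y : Measure (κ → ℝ)).real S + n * δ * Real.exp (n * ε) := by
  induction n generalizing x with
  | zero =>
    have h0 : ∑ i, |x i - y i| = 0 :=
      le_antisymm (by simpa using hxy) (Finset.sum_nonneg fun i _ => abs_nonneg _)
    have hx : x = y := by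
      funext i
      have := (Finset.sum_eq_zero_iff_of_nonneg fun i _ => abs_nonneg _).1 h0 i (Finset.mem_univ i)
      exact sub_eq_zero.1 (abs_eq_zero.1 this)
    simp [hx]
  | succ n ih =>
    push_cast at hxy ⊢
    have hn : (0 : ℝ) < n + 1 := by positivity
    -- One step of `ℓ₁` length at most `1` along the segment leaves distance at most `n`.
    set z : ι → ℝ := fun i => x i + (y i - x i) / (n + 1) with hz
    have hxz : Neighboring x z := by
      have h : ∀ i, |x i - z i| = |x i - y i| / (n + 1) := fun i => by
        have : x i - z i = (x i - y i) / (n + 1) := by simp only [hz]; ring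
        rw [this, abs_div, abs_of_pos hn]
      simp only [Neighboring, h, ← Finset.sum_div]
      rwa [div_le_one hn]
    have hzy : ∑ i, |z i - y i| ≤ n := by
      have h : ∀ i, |z i - y i| = (n / (n + 1) : ℝ) * |x i - y i| := fun i => by
        have : z i - y i = n / (n + 1) * (x i - y i) := by
          simp only [hz]
          field_simp
          ring
        rw [this, abs_mul, abs_of_nonneg (show (0 : ℝ) ≤ n / (n + 1) by positivity)]
      simp only [h, ← Finset.mul_sum]
      calc (n / (n + 1) : ℝ) * ∑ i, |x i - y i| ≤ n / (n + 1) * (n + 1) := by gcongr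
        _ = n := by field_simp
    have h1 := hM x z hxz S hS
    have h2 := mul_le_mul_of_nonneg_left (ih z hzy) (Real.exp_pos ε).le
    have he : Real.exp ((n + 1) * ε) = Real.exp ε * Real.exp (n * ε) := by
      rw [← Real.exp_add]; ring_nf
    have h3 : δ * 1 ≤ δ * Real.exp ((n + 1) * ε) :=
      mul_le_mul_of_nonneg_left (Real.one_le_exp (by positivity)) hδ
    rw [he] at h3 ⊢
    nlinarith

/-- Two distributions that are `(ε, δ)`-close in one direction cannot both concentrate around
points that are at distance `a` under a test statistic `f`. -/
theorem one_sub_mul_sq_le_of_indistinguishable {Ω : Type*} [MeasurableSpace Ω] (μ ν : Measure Ω)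
    [IsProbabilityMeasure μ] [IsProbabilityMeasure ν] {ε δ a b b' : ℝ} (hε : 0 ≤ ε)
    (ha : 0 ≤ a) (hb : a ≤ |b - b'|) {f : Ω → ℝ} (hf : Measurable f)
    (h : ∀ S, MeasurableSet S → μ.real S ≤ Real.exp ε * ν.real S + δ) :
    ENNReal.ofReal ((a / 2) ^ 2 * (1 - δ)) ≤ ENNReal.ofReal (Real.exp ε) *
      (∫⁻ y, ENNReal.ofReal ((f y - b) ^ 2) ∂μ + ∫⁻ y, ENNReal.ofReal ((f y - b') ^ 2) ∂ν) := by
  have key : ∀ (ρ : Measure Ω) [IsProbabilityMeasure ρ] (r : ℝ),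
      ENNReal.ofReal ((a / 2) ^ 2 * ρ.real {y | a / 2 ≤ |f y - r|}) ≤
        ∫⁻ y, ENNReal.ofReal ((f y - r) ^ 2) ∂ρ := by
    intro ρ _ r
    rw [ENNReal.ofReal_mul (by positivity), ofReal_measureReal]
    refine le_trans ?_ (mul_meas_ge_le_lintegral₀ (by fun_prop) (ENNReal.ofReal ((a / 2) ^ 2)))
    gcongr with y
    intro hy
    apply ENNReal.ofReal_le_ofReal
    rw [← sq_abs (f y - r)]
    exact pow_le_pow_left₀ (by positivity) hy 2
  have hmeas : ∀ r : ℝ, MeasurableSet {y | a / 2 ≤ |f y - r|} := fun r =>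
    measurableSet_le (by fun_prop) (by fun_prop)
  -- No value of `f` is within less than `a / 2` of both `b` and `b'`.
  have hcover : 1 ≤ μ.real {y | a / 2 ≤ |f y - b|} + μ.real {y | a / 2 ≤ |f y - b'|} := by
    refine le_trans ?_ (measureReal_union_le _ _)
    have : {y | a / 2 ≤ |f y - b|} ∪ {y | a / 2 ≤ |f y - b'|} = Set.univ := by
      refine Set.eq_univ_of_forall fun y => ?_
      by_contra hy
      simp only [Set.mem_union, Set.mem_ofPred_eq, not_or, not_le] at hy
      have := abs_sub_le b (f y) b'
      rw [abs_sub_comm b (f y)] at this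
      linarith
    simp [this]
  have h1 : (a / 2) ^ 2 * (1 - δ) ≤ Real.exp ε * ((a / 2) ^ 2 * μ.real {y | a / 2 ≤ |f y - b|} +
      (a / 2) ^ 2 * ν.real {y | a / 2 ≤ |f y - b'|}) := by
    have h2 := h _ (hmeas b')
    have h3 : μ.real {y | a / 2 ≤ |f y - b|} ≤ Real.exp ε * μ.real {y | a / 2 ≤ |f y - b|} :=
      le_mul_of_one_le_left measureReal_nonneg (Real.one_le_exp hε)
    have h4 := mul_le_mul_of_nonneg_left
      (show 1 - δ ≤ Real.exp ε * (μ.real {y | a / 2 ≤ |f y - b|} +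
        ν.real {y | a / 2 ≤ |f y - b'|}) by linarith) (sq_nonneg (a / 2))
    linarith
  calc _ ≤ _ := ENNReal.ofReal_le_ofReal h1
    _ = ENNReal.ofReal (Real.exp ε) *
        (ENNReal.ofReal ((a / 2) ^ 2 * μ.real {y | a / 2 ≤ |f y - b|}) +
          ENNReal.ofReal ((a / 2) ^ 2 * ν.real {y | a / 2 ≤ |f y - b'|})) := by
      rw [ENNReal.ofReal_mul (Real.exp_pos ε).le,
        ENNReal.ofReal_add (by positivity) (by positivity)]
    _ ≤ _ := by gcongr <;> exact key _ _

/-! ### Sign matrices with orthogonal rows -/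

/-- Parseval identity for a sign matrix with orthogonal rows. -/
theorem sum_sq_transpose_mulVec {ι κ : Type*} [Fintype ι] [Fintype κ] {A : Matrix κ ι ℝ}
    (hA : ∀ k j, A k j ^ 2 = 1) (horth : ∀ k l, k ≠ l → ∑ j, A k j * A l j = 0) (v : κ → ℝ) :
    ∑ j, (∑ k, A k j * v k) ^ 2 = Fintype.card ι * ∑ k, v k ^ 2 := by
  classical
  have h : ∀ k l, ∑ j, A k j * A l j = if k = l then (Fintype.card ι : ℝ) else 0 := by
    intro k l
    split_ifs with hkl
    · subst hkl
      simp [← sq, hA]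
    · exact horth k l hkl
  calc ∑ j, (∑ k, A k j * v k) ^ 2
      = ∑ j, ∑ k, ∑ l, (v k * v l) * (A k j * A l j) := by
        refine Finset.sum_congr rfl fun j _ => ?_
        rw [sq, Finset.sum_mul_sum]
        exact Finset.sum_congr rfl fun k _ => Finset.sum_congr rfl fun l _ => by ring
    _ = ∑ k, ∑ l, (v k * v l) * ∑ j, A k j * A l j := by
        rw [Finset.sum_comm]
        refine Finset.sum_congr rfl fun k _ => ?_
        rw [Finset.sum_comm]
        simp only [Finset.mul_sum]
    _ = _ := by
        simp only [h, mul_ite, mul_zero, Finset.sum_ite_eq, Finset.mem_univ, if_true,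
          Finset.mul_sum]
        exact Finset.sum_congr rfl fun k _ => by ring

/-- The mean squared error of a private mechanism, averaged over a cube of datasets: for a sign
matrix with orthogonal rows some dataset has mean squared error of order `t² m²`. -/
theorem exists_le_lintegral_sq_error {ι κ : Type} [Fintype ι] [Nonempty ι] [Fintype κ]
    {A : Matrix κ ι ℝ} (hA : ∀ k j, A k j ^ 2 = 1)
    (horth : ∀ k l, k ≠ l → ∑ j, A k j * A l j = 0) {M : Mechanism ι κ} {ε δ t : ℝ}
    (hε : 0 ≤ ε) (ht : 0 ≤ t)
    (hM : ∀ x y : ι → ℝ, ∑ i, |x i - y i| ≤ t → ∀ S, MeasurableSet S →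
      (M x : Measure (κ → ℝ)).real S ≤ Real.exp ε * (M y : Measure (κ → ℝ)).real S + δ) :
    ∃ x : ι → ℝ, ENNReal.ofReal (t ^ 2 * (Fintype.card κ : ℝ) ^ 2 * (1 - δ) * Real.exp (-ε) / 8) ≤
      ∫⁻ y, ENNReal.ofReal (∑ k, (y k - (A *ᵥ x) k) ^ 2) ∂(M x : Measure (κ → ℝ)) := by
  classical
  set pt : (ι → ℤˣ) → ι → ℝ := fun σ i => t / 2 * ((σ i : ℤ) : ℝ) with hpt
  set flip : ι → ι → ℤˣ := fun j => Pi.mulSingle j (-1) with hflip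
  set F : (ι → ℤˣ) → ι → ℝ≥0∞ := fun σ j =>
    ∫⁻ y, ENNReal.ofReal ((∑ k, A k j * y k - ∑ k, A k j * (A *ᵥ pt σ) k) ^ 2)
      ∂(M (pt σ) : Measure (κ → ℝ)) with hF
  set E : (ι → ℤˣ) → ℝ≥0∞ := fun σ =>
    ∫⁻ y, ENNReal.ofReal (∑ k, (y k - (A *ᵥ pt σ) k) ^ 2) ∂(M (pt σ) : Measure (κ → ℝ)) with hE
  set g : ℝ := (t * Fintype.card κ / 2) ^ 2 * (1 - δ) with hg
  have hdiff : ∀ σ j i, pt σ i - pt (σ * flip j) i =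
      if i = j then t * ((σ j : ℤ) : ℝ) else 0 := by
    intro σ j i
    split_ifs with hij
    · subst hij
      simp [hpt, hflip]
      ring
    · simp [hpt, hflip, hij]
  have hunit : ∀ s : ℤˣ, |((s : ℤ) : ℝ)| = 1 := by
    intro s
    rcases Int.units_eq_one_or s with rfl | rfl <;> simp
  have htwo : ∀ σ j, ENNReal.ofReal g ≤
      ENNReal.ofReal (Real.exp ε) * (F σ j + F (σ * flip j) j) := by
    intro σ j
    refine one_sub_mul_sq_le_of_indistinguishable _ _ hε (by positivity) (le_of_eq ?_)
      (by fun_prop) (hM _ _ (le_of_eq ?_))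
    · have h1 : ∀ k, (A *ᵥ pt σ) k - (A *ᵥ pt (σ * flip j)) k = A k j * (t * ((σ j : ℤ) : ℝ)) := by
        intro k
        simp only [Matrix.mulVec, dotProduct, ← Finset.sum_sub_distrib, ← mul_sub, hdiff]
        simp
      rw [← Finset.sum_sub_distrib]
      simp only [← mul_sub, h1, ← mul_assoc, ← sq, hA, one_mul]
      simp [abs_mul, hunit, abs_of_nonneg ht, mul_comm]
    · simp only [hdiff]
      rw [Finset.sum_eq_single j (by intro b _ hb; simp [hb]) (by simp)]
      simp [abs_mul, hunit, abs_of_nonneg ht]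
  -- This factor `card ι` later cancels against the number of coordinates `j`, so the size of the
  -- universe drops out.
  have hpars : ∀ σ, ∑ j, F σ j = Fintype.card ι * E σ := by
    intro σ
    rw [hF, hE]
    simp only
    rw [← lintegral_finsetSum _ (fun j _ => by fun_prop), ← lintegral_const_mul _ (by fun_prop)]
    refine lintegral_congr fun y => ?_
    rw [← ENNReal.ofReal_sum_of_nonneg (fun j _ => sq_nonneg _)]
    simp only [← Finset.sum_sub_distrib, ← mul_sub]
    rw [sum_sq_transpose_mulVec hA horth, ENNReal.ofReal_mul (by positivity),
      ENNReal.ofReal_natCast]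
  have hsum : ∑ σ : ι → ℤˣ, ∑ j : ι, ENNReal.ofReal g ≤
      ∑ σ : ι → ℤˣ, Fintype.card ι * (ENNReal.ofReal (2 * Real.exp ε) * E σ) := by
    calc _ ≤ ∑ σ, ∑ j, ENNReal.ofReal (Real.exp ε) * (F σ j + F (σ * flip j) j) :=
          Finset.sum_le_sum fun σ _ => Finset.sum_le_sum fun j _ => htwo σ j
      _ = ENNReal.ofReal (Real.exp ε) *
          (∑ σ, ∑ j, F σ j + ∑ σ, ∑ j, F (σ * flip j) j) := by
          simp only [← Finset.mul_sum, Finset.sum_add_distrib]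
      _ = ENNReal.ofReal (Real.exp ε) * (∑ σ, ∑ j, F σ j + ∑ σ, ∑ j, F σ j) := by
          congr 2
          rw [Finset.sum_comm, Finset.sum_comm (f := fun σ j => F σ j)]
          exact Finset.sum_congr rfl fun j _ =>
            Equiv.sum_comp (Equiv.mulRight (flip j)) fun σ => F σ j
      _ = _ := by
          simp only [hpars, ← Finset.mul_sum]
          rw [ENNReal.ofReal_mul (by norm_num), ENNReal.ofReal_ofNat]
          ring
  simp only [Finset.sum_const (ENNReal.ofReal g), Finset.card_univ, nsmul_eq_mul] at hsum
  obtain ⟨σ, hσ⟩ : ∃ σ, (Fintype.card ι : ℝ≥0∞) * ENNReal.ofReal g ≤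
      Fintype.card ι * (ENNReal.ofReal (2 * Real.exp ε) * E σ) := by
    by_contra! h
    exact hsum.not_gt (ENNReal.sum_lt_sum_of_nonempty Finset.univ_nonempty fun σ _ => h σ)
  rw [ENNReal.mul_le_mul_iff_right (by simp) (by simp)] at hσ
  refine ⟨pt σ, ?_⟩
  have h8 : t ^ 2 * (Fintype.card κ : ℝ) ^ 2 * (1 - δ) * Real.exp (-ε) / 8 =
      (2 * Real.exp ε)⁻¹ * g := by
    rw [hg, Real.exp_neg]
    field_simp
    ring
  rw [h8, ENNReal.ofReal_mul (by positivity), ENNReal.ofReal_inv_of_pos (by positivity)]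
  have : 0 < Real.exp ε := Real.exp_pos ε
  rwa [ENNReal.inv_mul_le_iff (by simpa using this) ENNReal.ofReal_ne_top]

/-- Lower bound on the worst-case `ℓ_p^p` error for a sign matrix with orthogonal rows. -/
theorem le_lppError_of_orthogonal {ι κ : Type} [Fintype ι] [Nonempty ι] [Fintype κ] [Nonempty κ]
    {A : Matrix κ ι ℝ} (hA : ∀ k j, A k j ^ 2 = 1)
    (horth : ∀ k l, k ≠ l → ∑ j, A k j * A l j = 0) {M : Mechanism ι κ} {p ε δ t : ℝ}
    (hp : 2 ≤ p) (hε : 0 ≤ ε) (hδ : δ < 1) (ht : 0 < t)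
    (hM : ∀ x y : ι → ℝ, ∑ i, |x i - y i| ≤ t → ∀ S, MeasurableSet S →
      (M x : Measure (κ → ℝ)).real S ≤ Real.exp ε * (M y : Measure (κ → ℝ)).real S + δ) :
    ENNReal.ofReal (t * √((1 - δ) * Real.exp (-ε) / 32) *
      (Fintype.card κ : ℝ) ^ (1 / 2 + 1 / p)) ≤ lppError p M A := by
  obtain ⟨x, hx⟩ := exists_le_lintegral_sq_error hA horth hε ht.le hM
  have hm : (0 : ℝ) < Fintype.card κ := by exact_mod_cast Fintype.card_pos
  set m : ℝ := ((Fintype.card κ : ℕ) : ℝ) with hmdef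
  set B : ℝ := (1 - δ) * Real.exp (-ε) / 32 with hB
  have hBpos : 0 < B := by
    have := Real.exp_pos (-ε)
    have : 0 < 1 - δ := by linarith
    positivity
  -- Chosen so that the squared error is at least `4 m T²`, while an `ℓ_p^p` error below the claim
  -- would force at most `2 m T²`.
  set T : ℝ := t * √(B * m) with hT
  have hTpos : 0 < T := by positivity
  have hT2 : T ^ 2 = t ^ 2 * (B * m) := by rw [hT, mul_pow, Real.sq_sqrt (by positivity)]
  have hR : t * √B * m ^ (1 / 2 + 1 / p) = T * m ^ (1 / p) := by
    rw [hT, Real.sqrt_mul hBpos.le, Real.rpow_add hm, Real.sqrt_eq_rpow m]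
    ring
  have hpos : 0 < p := by linarith
  rw [hR]
  by_contra! hlt
  set I : ℝ≥0∞ := ∫⁻ y, ENNReal.ofReal (∑ k, |y k - (A *ᵥ x) k| ^ p) ∂(M x : Measure (κ → ℝ))
    with hI
  have hIle : I ≤ ENNReal.ofReal (T ^ p * m) := by
    have h1 : I ^ (1 / p) ≤ ENNReal.ofReal (T * m ^ (1 / p)) :=
      (le_iSup (fun x : ι → ℝ => (∫⁻ y, ENNReal.ofReal (∑ k, |y k - (A *ᵥ x) k| ^ p)
        ∂(M x : Measure (κ → ℝ))) ^ (1 / p)) x).trans hlt.le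
    have h2 := ENNReal.rpow_le_rpow h1 hpos.le
    rw [← ENNReal.rpow_mul, one_div_mul_cancel hpos.ne', ENNReal.rpow_one,
      ENNReal.ofReal_rpow_of_nonneg (by positivity) hpos.le,
      Real.mul_rpow hTpos.le (by positivity), ← Real.rpow_mul hm.le,
      one_div_mul_cancel hpos.ne', Real.rpow_one] at h2
    exact h2
  -- Truncation at `T`; above it, `p ≥ 2` makes `|a| ^ (2 - p)` decreasing in `|a|`.
  have hpt : ∀ a : ℝ, a ^ 2 ≤ T ^ 2 + T ^ (2 - p) * |a| ^ p := by
    intro a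
    rcases le_total |a| T with h | h
    · have : a ^ 2 ≤ T ^ 2 := by
        rw [← sq_abs]
        gcongr
      have : 0 ≤ T ^ (2 - p) * |a| ^ p := by positivity
      linarith
    · have ha : 0 < |a| := hTpos.trans_le h
      have h1 : |a| ^ (2 - p) ≤ T ^ (2 - p) :=
        Real.rpow_le_rpow_of_nonpos hTpos h (by linarith)
      have h2 : a ^ 2 = |a| ^ (2 - p) * |a| ^ p := by
        rw [← Real.rpow_add ha, sub_add_cancel, ← sq_abs]
        norm_cast
      rw [h2]
      nlinarith [Real.rpow_nonneg ha.le p, sq_nonneg T]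
  have hup : ∫⁻ y, ENNReal.ofReal (∑ k, (y k - (A *ᵥ x) k) ^ 2) ∂(M x : Measure (κ → ℝ)) ≤
      ENNReal.ofReal (2 * (m * T ^ 2)) := by
    calc _ ≤ ∫⁻ y, (ENNReal.ofReal (m * T ^ 2) + ENNReal.ofReal (T ^ (2 - p)) *
            ENNReal.ofReal (∑ k, |y k - (A *ᵥ x) k| ^ p)) ∂(M x : Measure (κ → ℝ)) := by
          refine lintegral_mono fun y => ?_
          rw [← ENNReal.ofReal_mul (by positivity), ← ENNReal.ofReal_add (by positivity)
            (by positivity)]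
          apply ENNReal.ofReal_le_ofReal
          calc _ ≤ ∑ k, (T ^ 2 + T ^ (2 - p) * |y k - (A *ᵥ x) k| ^ p) :=
                Finset.sum_le_sum fun k _ => hpt _
            _ = _ := by
                simp [Finset.sum_add_distrib, Finset.mul_sum, hmdef]
      _ = ENNReal.ofReal (m * T ^ 2) + ENNReal.ofReal (T ^ (2 - p)) * I := by
          rw [lintegral_add_left measurable_const, lintegral_const, measure_univ, mul_one,
            lintegral_const_mul' _ _ ENNReal.ofReal_ne_top]
      _ ≤ ENNReal.ofReal (m * T ^ 2) +
          ENNReal.ofReal (T ^ (2 - p)) * ENNReal.ofReal (T ^ p * m) := by gcongr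
      _ = _ := by
          rw [← ENNReal.ofReal_mul (by positivity), ← ENNReal.ofReal_add (by positivity)
            (by positivity), ← mul_assoc, ← Real.rpow_add hTpos, sub_add_cancel]
          congr 1
          norm_cast
          ring
  have hfin := (ENNReal.ofReal_le_ofReal_iff (by positivity)).1 (hx.trans hup)
  have h4 : t ^ 2 * m ^ 2 * (1 - δ) * Real.exp (-ε) / 8 = 4 * (m * T ^ 2) := by
    rw [hT2, hB]
    ring
  have : 0 < m * T ^ 2 := by positivity
  linarith

/-! ### Parity queries and choice of parameters -/

theorem parityMatrix_sq {d w : ℕ} (P : ParityIndex d w) (u : SignCube d) :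
    parityMatrix d w P u ^ 2 = 1 := by
  rw [parityMatrix, parityQuery, ← Finset.prod_pow]
  refine Finset.prod_eq_one fun i _ => ?_
  rcases Int.units_eq_one_or (u i) with h | h <;> simp [h]

/-- The sum factors over coordinates, and one in the symmetric difference contributes `1 + (-1) =
0`. -/
theorem parityMatrix_orthogonal {d w : ℕ} (P P' : ParityIndex d w) (h : P ≠ P') :
    ∑ u, parityMatrix d w P u * parityMatrix d w P' u = 0 := by
  set f : Fin d → ℤˣ → ℝ := fun i s =>
    (if i ∈ P.1 then ((s : ℤ) : ℝ) else 1) * (if i ∈ P'.1 then ((s : ℤ) : ℝ) else 1) with hf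
  have h1 : ∀ u : SignCube d,
      parityMatrix d w P u * parityMatrix d w P' u = ∏ i, f i (u i) := by
    intro u
    simp only [parityMatrix, parityQuery, hf, Finset.prod_mul_distrib]
    simp
  have hne : P.1 ≠ P'.1 := fun e => h (Subtype.ext e)
  obtain ⟨i, hi⟩ : ∃ i, ¬(i ∈ P.1 ↔ i ∈ P'.1) := by
    by_contra! hc
    exact hne (Finset.ext hc)
  have h2 := Finset.prod_univ_sum (fun _ : Fin d => (Finset.univ : Finset ℤˣ)) f
  rw [Fintype.piFinset_univ] at h2
  simp only [h1]
  rw [← h2]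
  refine Finset.prod_eq_zero (Finset.mem_univ i) ?_
  have hu : (Finset.univ : Finset ℤˣ) = {1, -1} := by decide
  rw [hu, Finset.sum_pair (by decide)]
  by_cases hP : i ∈ P.1 <;> by_cases hP' : i ∈ P'.1 <;> simp_all

theorem mainTheorem9 (K : ℝ) (hK : 0 < K) :
    ∃ c : ℝ, 0 < c ∧
      ∀ (d w : ℕ) (p ε δ : ℝ), 2 ≤ p → 0 < ε → 0 ≤ δ → δ < 1 → δ ≤ K * ε →
        ∀ M : Mechanism (SignCube d) (ParityIndex d w),
          IsDifferentiallyPrivate M ε δ →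
            ENNReal.ofReal
                (c * ((1 - δ) / (Real.exp (3 * ε) - 1) * (d.choose w : ℝ) ^ (1 / 2 + 1 / p)))
              ≤ lppError p M (parityMatrix d w) := by
  -- Threshold between the regimes; `K ε₀ ≤ 1/6` keeps the group-privacy `δ'` at most `1/2`.
  set ε₀ : ℝ := 1 / (6 * (K + 1)) with hε₀
  have hε₀pos : 0 < ε₀ := by positivity
  have hε₀le : ε₀ ≤ 1 := by
    rw [hε₀, div_le_one (by positivity)]
    linarith
  have hKε₀ : K * ε₀ ≤ 1 / 6 := by
    rw [hε₀, mul_one_div, div_le_div_iff₀ (by positivity) (by norm_num)]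
    linarith
  refine ⟨ε₀ / 10, by positivity, ?_⟩
  intro d w p ε δ hp hε hδ hδ1 hδK M hM
  have hcard : Fintype.card (ParityIndex d w) = d.choose w := by
    simp [ParityIndex, Fintype.card_finset_len]
  have hpos : 0 < p := by linarith
  rcases Nat.eq_zero_or_pos (d.choose w) with h0 | hm
  · have : (1 / 2 + 1 / p) ≠ 0 := by positivity
    simp only [h0, Nat.cast_zero, Real.zero_rpow this, mul_zero, ENNReal.ofReal_zero, zero_le]
  have : Nonempty (ParityIndex d w) := Fintype.card_pos_iff.1 (hcard ▸ hm)
  have hden : 3 * ε ≤ Real.exp (3 * ε) - 1 := by linarith [Real.add_one_le_exp (3 * ε)]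
  suffices H : ∃ t ε' δ' : ℝ, 0 < t ∧ 0 ≤ ε' ∧ δ' < 1 ∧
      (∀ x y : SignCube d → ℝ, ∑ i, |x i - y i| ≤ t → ∀ S, MeasurableSet S →
        (M x : Measure (ParityIndex d w → ℝ)).real S ≤
          Real.exp ε' * (M y : Measure (ParityIndex d w → ℝ)).real S + δ') ∧
      ε₀ / 10 * ((1 - δ) / (Real.exp (3 * ε) - 1)) ≤
        t * √((1 - δ') * Real.exp (-ε') / 32) by
    obtain ⟨t, ε', δ', ht, hε', hδ', hM', hle⟩ := H
    refine le_trans (ENNReal.ofReal_le_ofReal ?_)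
      (le_lppError_of_orthogonal parityMatrix_sq parityMatrix_orthogonal hp hε' hδ' ht hM')
    rw [hcard, ← mul_assoc]
    gcongr
  rcases le_or_gt ε₀ ε with hlarge | hsmall
  · refine ⟨1, ε, δ, one_pos, hε.le, hδ1, fun x y hxy S hS => hM x y hxy S hS, ?_⟩
    rw [one_mul]
    have hx : 0 < Real.exp (-ε) := Real.exp_pos _
    have hx1 : Real.exp (-ε) ≤ 1 := Real.exp_le_one_iff.2 (by linarith)
    have hy : 0 < 1 - δ := by linarith
    have hy1 : 1 - δ ≤ 1 := by linarith
    -- On `[0, 1]`, `s² / 36 ≤ s / 32`.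
    have hsq : (1 - δ) * Real.exp (-ε) / 6 ≤ √((1 - δ) * Real.exp (-ε) / 32) := by
      apply Real.le_sqrt_of_sq_le
      have h1 : (1 - δ) * Real.exp (-ε) ≤ 1 := mul_le_one₀ hy1 hx.le hx1
      have h2 : 0 < (1 - δ) * Real.exp (-ε) := by positivity
      nlinarith
    refine le_trans ?_ hsq
    have hexp : Real.exp ε * (2 * ε₀) ≤ Real.exp (3 * ε) - 1 := by
      have h3 : Real.exp (3 * ε) = Real.exp ε * Real.exp (2 * ε) := by
        rw [← Real.exp_add]; ring_nf
      have h2 : 2 * ε + 1 ≤ Real.exp (2 * ε) := Real.add_one_le_exp _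
      have h1 : 1 ≤ Real.exp ε := Real.one_le_exp hε.le
      rw [h3]
      nlinarith
    calc ε₀ / 10 * ((1 - δ) / (Real.exp (3 * ε) - 1))
        ≤ ε₀ / 10 * ((1 - δ) / (Real.exp ε * (2 * ε₀))) := by gcongr
      _ = (1 - δ) * Real.exp (-ε) / 20 := by
          rw [Real.exp_neg]
          field_simp
          norm_num
      _ ≤ _ := by
          have : 0 < (1 - δ) * Real.exp (-ε) := by positivity
          linarith
  -- The largest group size with `n ε ≤ ε₀`; rounding down loses at most a factor `2`.
  · set n : ℕ := ⌊ε₀ / ε⌋₊ with hn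
    have hn1 : 1 ≤ n := Nat.one_le_floor_iff _ |>.2 ((one_le_div hε).2 hsmall.le)
    have hn1' : (1 : ℝ) ≤ n := by exact_mod_cast hn1
    have hnε : n * ε ≤ ε₀ := by
      rw [← le_div_iff₀ hε]
      exact Nat.floor_le (by positivity)
    have hnε' : ε₀ ≤ 2 * n * ε := by
      have : ε₀ / ε < n + 1 := Nat.lt_floor_add_one _
      rw [div_lt_iff₀ hε] at this
      nlinarith
    have hexp3 : Real.exp (n * ε) ≤ 3 := by
      have : Real.exp (n * ε) ≤ Real.exp 1 := Real.exp_le_exp.2 (hnε.trans hε₀le)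
      linarith [Real.exp_one_lt_d9]
    have hδ' : n * δ * Real.exp (n * ε) ≤ 1 / 2 := by
      have h1 : n * δ ≤ 1 / 6 := by
        calc n * δ ≤ n * (K * ε) := by gcongr
          _ = K * (n * ε) := by ring
          _ ≤ K * ε₀ := by gcongr
          _ ≤ 1 / 6 := hKε₀
      calc n * δ * Real.exp (n * ε) ≤ 1 / 6 * 3 := by gcongr
        _ = 1 / 2 := by norm_num
    refine ⟨n, n * ε, n * δ * Real.exp (n * ε), by linarith, by positivity, by linarith,
      hM.group hε.le hδ n, ?_⟩
    -- `(1/2) (1/3) / 32 = 1/192 ≥ 1/14²`.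
    have hsq : (1 / 14 : ℝ) ≤
        √((1 - n * δ * Real.exp (n * ε)) * Real.exp (-(n * ε)) / 32) := by
      apply Real.le_sqrt_of_sq_le
      have h1 : 1 / 3 ≤ Real.exp (-(n * ε)) := by
        rw [Real.exp_neg, ← one_div]
        exact one_div_le_one_div_of_le (Real.exp_pos _) hexp3
      nlinarith
    calc ε₀ / 10 * ((1 - δ) / (Real.exp (3 * ε) - 1))
        ≤ ε₀ / 10 * (1 / (3 * ε)) := by
          have : 0 < 3 * ε := by linarith
          gcongr
          linarith
      _ ≤ 2 * n * ε / 10 * (1 / (3 * ε)) := by gcongr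
      _ = n * (1 / 15) := by
          field_simp
          norm_num
      _ ≤ n * (1 / 14) := by gcongr; norm_num
      _ ≤ _ := by gcongr
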